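/- Let $0<r_i<r_e$, let $n\ge 1$ be an integer, and let $D=\{x\in\mathbb{R}^2:|x|<r_i\}$ and $\Omega=\{x\in\mathbb{R}^2:|x|<r_e\}$, with outward unit normal $\nu=x/|x|$ on their boundaries. In polar coordinates $(r,\theta)$, let $H=r^n e^{\mathrm{i}n\theta}$ be the background electrostatic potential and $P=12\,r^n e^{\mathrm{i}n\theta}$ the background pressure. For $\zeta_0\in\mathbb{R}$ consider the system for complex-valued $\varphi,p$ \[ \begin{cases} \Delta\varphi=0 & \text{in } \mathbb{R}^2\setminus\overline{D},\\ \partial\varphi/\partial\nu=0 & \text{on } \partial D,\\ \varphi=H+O(|x|^{-1}) & \text{as } |x|\to\infty,\\ \Delta p=0 & \text{in } \Omega\setminus\overline{D} \text{ and in } \mathbb{R}^2\setminus\overline{\Omega},\\ \partial p/\partial\nu=0 & \text{on } \partial D,\\ p|_+=p|_- & \text{on } \partial\Omega,\\ \frac{\partial p}{\partial\nu}\big|_+-\frac{\partial p}{\partial\nu}\big|_-=12\,\zeta_0\,\frac{\partial\varphi}{\partial\nu} & \text{on } \partial\Omega,\\ p=P+O(|x|^{-1}) & \text{as } |x|\to\infty,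 \end{cases} \] where $\frac{\partial f}{\partial\nu}\big|_\pm(x)=\lim_{t\to0^+}\langle\nabla f(x\pm t\nu(x)),\nu(x)\rangle$ (on $\partial D$ the normal derivative is taken from outside $D$). A classical solution is a pair $(\varphi,p)$ of functions continuous on $\mathbb{R}^2\setminus D$, with $\varphi$ of class $C^2$ in $\mathbb{R}^2\setminus\overline{D}$ and $p$ of class $C^2$ in $\Omega\setminus\overline{D}$ and in $\mathbb{R}^2\setminus\overline{\Omega}$, that satisfies this system. Let $\zeta_{mean}=\zeta_0$ in $\Omega\setminus\overline{D}$ and $\zeta_{mean}=0$ in $\mathbb{R}^2\setminus\overline{\Omega}$, let $u_{aver}=-\frac1{12}\nabla p-\zeta_{mean}\nabla\varphi$ be the depth-averaged velocity, and let $F=\int_{\partial D}(-p\,I)\,\nu\,ds$ be the hydrodynamic force on $D$. (1) (Perfect hydrodynamic cloaking.) If \[ \zeta_0=\frac{2r_i^{2n}r_e^{2n}}{r_e^{4n}-r_i^{4n}}, \] then the system has a classical solution, and every classical solution satisfies $p=P$ and $u_{aver}=-\nabla P/12$ in $\mathbb{R}^2\setminus\overline{\Omega}$. (2) (Perfect hydrodynamic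 shielding.) If \[ \zeta_0=\frac{2r_e^{2n}}{r_e^{2n}-r_i^{2n}}, \] then the system has a classical solution, and every classical solution satisfies $p=0$ in $\Omega\setminus\overline{D}$ and $F=0$. -/

import Mathlib

open Set Filter Topology Asymptotics MeasureTheory InnerProductSpace
open scoped MeasureTheory

/-! The plane is `ℂ`, regarded as a real Euclidean plane with coordinates `x₁ = re`, `x₂ = im`.
Scalar fields are complex-valued, so that `r ^ n * exp (i n θ)` is allowed as a background field;
vector fields take values in `ℂ²`, written `Fin 2 → ℂ`. -/

/-- The gradient `(∂f/∂x₁, ∂f/∂x₂)` of a complex-valued field on the plane. -/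
noncomputable def planeGrad (f : ℂ → ℂ) (x : ℂ) : Fin 2 → ℂ :=
  ![fderiv ℝ f x 1, fderiv ℝ f x Complex.I]

/-- `∂f/∂ν|₊ (x) = a`: the limit of `⟨∇f(x + t ν), ν⟩` as `t → 0⁺` is `a`. -/
def HasOuterNormalDeriv (f : ℂ → ℂ) (ν x : ℂ) (a : ℂ) : Prop :=
  Tendsto (fun t : ℝ => fderiv ℝ f (x + t • ν) ν) (𝓝[>] 0) (𝓝 a)

/-- `∂f/∂ν|₋ (x) = a`: the limit of `⟨∇f(x - t ν), ν⟩` as `t → 0⁺` is `a`. -/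
def HasInnerNormalDeriv (f : ℂ → ℂ) (ν x : ℂ) (a : ℂ) : Prop :=
  Tendsto (fun t : ℝ => fderiv ℝ f (x - t • ν) ν) (𝓝[>] 0) (𝓝 a)

/-- The zeta potential: `ζ₀` in the control region `Ω \ closure D`, and `0` outside `Ω`. -/
noncomputable def zetaMean (D Ω : Set ℂ) (ζ₀ : ℝ) : ℂ → ℝ :=
  (Ω \ closure D).indicator fun _ => ζ₀

/-- `(φ, p)` is a classical solution of the electro-osmosis system for the object `D`, the region
`Ω`, the zeta potential `ζ₀` and the background fields `H` and `P`. Here `νD` and `νΩ` are the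
outward unit normal fields on the boundaries of `D` and of `Ω`. The potential `φ` is `C²` outside
`closure D`, the pressure `p` is `C²` on either side of the interface `frontier Ω`, and both are
continuous outside `D`, which for `p` contains the transmission condition `p|₊ = p|₋`. -/
structure IsElectroOsmoticSolution (D Ω : Set ℂ) (νD νΩ : ℂ → ℂ) (ζ₀ : ℝ) (H P : ℂ → ℂ)
    (φ p : ℂ → ℂ) : Prop where
  potential_harmonic : HarmonicOnNhd φ (closure D)ᶜ
  potential_continuous : ContinuousOn φ Dᶜ
  potential_insulation : ∀ x ∈ frontier D, HasOuterNormalDeriv φ (νD x) x 0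
  potential_infinity :
    (fun x => φ x - H x) =O[Bornology.cobounded ℂ] fun x => (‖x‖⁻¹ : ℝ)
  pressure_harmonic_inside : HarmonicOnNhd p (Ω \ closure D)
  pressure_harmonic_outside : HarmonicOnNhd p (closure Ω)ᶜ
  pressure_continuous : ContinuousOn p Dᶜ
  pressure_no_penetration : ∀ x ∈ frontier D, HasOuterNormalDeriv p (νD x) x 0
  pressure_jump : ∀ x ∈ frontier Ω, ∃ a b : ℂ,
    HasOuterNormalDeriv p (νΩ x) x a ∧ HasInnerNormalDeriv p (νΩ x) x b ∧
      a - b = 12 * ζ₀ * fderiv ℝ φ x (νΩ x)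
  pressure_infinity :
    (fun x => p x - P x) =O[Bornology.cobounded ℂ] fun x => (‖x‖⁻¹ : ℝ)

/-- The depth-averaged velocity `-∇p / 12 - ζ_mean ∇φ`. -/
noncomputable def averageVelocity (D Ω : Set ℂ) (ζ₀ : ℝ) (φ p : ℂ → ℂ) (x : ℂ) : Fin 2 → ℂ :=
  -((1 / 12 : ℂ) • planeGrad p x) - (zetaMean D Ω ζ₀ x : ℂ) • planeGrad φ x

/-- The normalized stress tensor `σ = -p I`. -/
noncomputable def stressTensor (p : ℂ → ℂ) (x : ℂ) : Matrix (Fin 2) (Fin 2) ℂ :=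
  -(p x • (1 : Matrix (Fin 2) (Fin 2) ℂ))

/-- The depth-averaged force `∫_{∂D} σ ν ds` on the object `D`; the arc length on the boundary is
the one-dimensional Hausdorff measure. -/
noncomputable def hydrodynamicForce (D : Set ℂ) (νD : ℂ → ℂ) (p : ℂ → ℂ) : Fin 2 → ℂ :=
  ∫ y in frontier D, (stressTensor p y).mulVec ![((νD y).re : ℂ), ((νD y).im : ℂ)] ∂μH[1]

/-- The outward unit normal `x / |x|` on every circle centred at the origin. -/
noncomputable def radialNormal (x : ℂ) : ℂ := x / (‖x‖ : ℂ)

/-- The field `r ^ n * exp (i n θ)` in polar coordinates `x = r exp (i θ)`. -/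
noncomputable def polarHarmonic (n : ℕ) (x : ℂ) : ℂ :=
  (‖x‖ : ℂ) ^ n * Complex.exp (Complex.I * n * (x.arg : ℂ))

/-- The system for the concentric disks `D = {|x| < rᵢ}` and `Ω = {|x| < rₑ}` with the background
fields `H = r ^ n exp (i n θ)` and `P = 12 r ^ n exp (i n θ)`. -/
def IsAnnulusSolution (n : ℕ) (ri re ζ₀ : ℝ) (φ p : ℂ → ℂ) : Prop :=
  IsElectroOsmoticSolution (Metric.ball 0 ri) (Metric.ball 0 re) radialNormal radialNormal ζ₀
    (polarHarmonic n) (fun x => 12 * polarHarmonic n x) φ p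

/-! Both claims follow from uniqueness together with one explicit solution for each value of `ζ₀`.

Existence. In the angular mode `exp (i n θ)` the radial factors are `r ^ n` and `r ^ (-n)`. The
Neumann condition at `ri` fixes the ratio of the two coefficients in the annulus, and the background
fixes the growing coefficient at infinity. Two unknowns remain for the pressure: the annular
amplitude `a` and the exterior decaying coefficient `c`. Continuity and the flux jump at `re` are
two linear equations for them (`isAnnulusSolution_annularField`). The cloaking `ζ₀` is the one
giving `c = 0`, the shielding `ζ₀` the one giving `a = 0`.

Uniqueness. The difference of two solutions solves a homogeneous transmission problem with decay at
infinity, and `IsHomogeneousTransmission.eq_zero` shows that it vanishes, by a maximum principle. To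
a real component of the difference one adds `ε * barrier`, which makes the sum strictly subharmonic
off the interface, strictly increasing at the inner circle, and gives it an upward kink at the
interface. So a maximum can only lie on a large circle, where decay rules it out. -/

/-! ### Second-order conditions at a local maximum -/

/-- A function on the line has nonpositive second derivative at a local maximum. -/
theorem IsLocalMax.deriv_deriv_nonpos {g : ℝ → ℝ} {a : ℝ} (h : IsLocalMax g a)
    (hc : ContinuousAt g a) : deriv (deriv g) a ≤ 0 := by
  by_contra! hpos
  -- A positive second derivative would make `a` a local minimum as well, so `g` would be constant
  -- near `a`.
  have hmin := isLocalMin_of_deriv_deriv_pos hpos h.deriv_eq_zero hc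
  have hconst : g =ᶠ[𝓝 a] fun _ => g a := by
    filter_upwards [h, hmin] with t h₁ h₂ using le_antisymm h₁ h₂
  have := hconst.deriv.deriv_eq
  simp_all

theorem IsLocalMax.iteratedFDeriv_two_nonpos {E : Type*} [NormedAddCommGroup E] [NormedSpace ℝ E]
    {f : E → ℝ} {x : E} (h : IsLocalMax f x) (hf : ContDiffAt ℝ 2 f x) (e : E) :
    iteratedFDeriv ℝ 2 f x ![e, e] ≤ 0 := by
  have hline (t : ℝ) : HasDerivAt (fun t : ℝ => x + t • e) e t := by
    simpa using ((hasDerivAt_id t).smul_const e).const_add x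
  have hx : Tendsto (fun t : ℝ => x + t • e) (𝓝 0) (𝓝 x) := by
    simpa [ContinuousAt] using (hline 0).continuousAt
  have hderiv : deriv (fun t : ℝ => f (x + t • e)) =ᶠ[𝓝 0] fun t => fderiv ℝ f (x + t • e) e := by
    filter_upwards [hx.eventually (hf.eventually (by simp))] with t ht
    exact ((ht.differentiableAt (by simp)).hasFDerivAt.comp_hasDerivAt t (hline t)).deriv
  have hf' : DifferentiableAt ℝ (fderiv ℝ f) (x + (0 : ℝ) • e) := by
    simpa using (hf.fderiv_right (m := 1) (by norm_num)).differentiableAt (by simp)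
  have hsecond : deriv (deriv (fun t : ℝ => f (x + t • e))) 0 =
      iteratedFDeriv ℝ 2 f x ![e, e] := by
    rw [hderiv.deriv_eq, iteratedFDeriv_two_apply]
    have h2 : HasDerivAt (fun t : ℝ => fderiv ℝ f (x + t • e))
        (fderiv ℝ (fderiv ℝ f) (x + (0 : ℝ) • e) e) 0 :=
      HasFDerivAt.comp_hasDerivAt (f := fun t : ℝ => x + t • e) 0 hf'.hasFDerivAt (hline 0)
    have h3 := (h2.clm_apply (hasDerivAt_const 0 e)).deriv
    rw [h3]
    simp
  rw [← hsecond]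
  refine IsLocalMax.deriv_deriv_nonpos ?_ ?_
  · have := hx.eventually h
    simpa [IsLocalMax, IsMaxFilter] using this
  · have hc : ContinuousAt f (x + (0 : ℝ) • e) := by simpa using hf.continuousAt
    exact ContinuousAt.comp (f := fun t : ℝ => x + t • e) hc (hline 0).continuousAt

theorem IsLocalMax.laplacian_nonpos {f : ℂ → ℝ} {x : ℂ} (h : IsLocalMax f x)
    (hf : ContDiffAt ℝ 2 f x) : Laplacian.laplacian f x ≤ 0 := by
  rw [laplacian_eq_iteratedFDeriv_complexPlane]
  exact add_nonpos (h.iteratedFDeriv_two_nonpos hf _) (h.iteratedFDeriv_two_nonpos hf _)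

theorem laplacian_const_mul_norm_sq (k : ℝ) (x : ℂ) :
    Laplacian.laplacian (fun z : ℂ => k * ‖z‖ ^ 2) x = 4 * k := by
  have hfd : fderiv ℝ (fun z : ℂ => k * ‖z‖ ^ 2) = fun z => ((2 * k) • innerSL ℝ (E := ℂ)) z := by
    funext z
    rw [fderiv_const_mul ((contDiff_norm_sq ℝ (n := 1)).differentiable (by simp) z), fderiv_norm_sq]
    ext
    all_goals
      simp
      ring
  rw [laplacian_eq_iteratedFDeriv_complexPlane]
  simp only [iteratedFDeriv_two_apply, hfd]
  rw [ContinuousLinearMap.fderiv]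
  have h1 (z : ℂ) : innerSL ℝ z z = ‖z‖ ^ 2 := by
    rw [innerSL_apply_apply, real_inner_self_eq_norm_sq]
  simp [-coe_innerSL_apply, h1]
  ring

theorem InnerProductSpace.HarmonicAt.not_isLocalMax_add_norm_sq {u : ℂ → ℝ} {x : ℂ}
    (hu : HarmonicAt u x) {k : ℝ} (hk : 0 < k) : ¬ IsLocalMax (fun z => u z + k * ‖z‖ ^ 2) x := by
  intro h
  have hq : ContDiffAt ℝ 2 (fun z : ℂ => k * ‖z‖ ^ 2) x :=
    (contDiff_const.mul (contDiff_norm_sq ℝ)).contDiffAt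
  have h1 : Laplacian.laplacian (u + fun z : ℂ => k * ‖z‖ ^ 2) x ≤ 0 :=
    IsLocalMax.laplacian_nonpos h (hu.1.add hq)
  rw [hu.1.laplacian_add hq, laplacian_const_mul_norm_sq, hu.2.self_of_nhds] at h1
  simp at h1
  linarith

/-! ### One-sided normal derivatives along rays -/

/-- A linear bound on a field along a ray bounds its normal derivative. -/
theorem HasOuterNormalDeriv.map_le {w : ℂ → ℂ} {x ν a : ℂ} (L : ℂ →L[ℝ] ℝ) {k : ℝ}
    (ha : HasOuterNormalDeriv w ν x a)
    (hc : Tendsto (fun t : ℝ => w (x + t • ν)) (𝓝[>] 0) (𝓝 (w x)))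
    (hd : ∀ᶠ t : ℝ in 𝓝[>] 0, DifferentiableAt ℝ w (x + t • ν))
    (hk : ∀ᶠ t : ℝ in 𝓝[>] 0, L (w (x + t • ν)) + k * t ≤ L (w x)) : L a ≤ -k := by
  have hline (t : ℝ) : HasDerivAt (fun t : ℝ => x + t • ν) ν t := by
    simpa using ((hasDerivAt_id t).smul_const ν).const_add x
  have hderiv (t : ℝ) (ht : DifferentiableAt ℝ w (x + t • ν)) :
      HasDerivAt (fun t : ℝ => L (w (x + t • ν))) (L (fderiv ℝ w (x + t • ν) ν)) t :=
    L.hasFDerivAt.comp_hasDerivAt t (ht.hasFDerivAt.comp_hasDerivAt t (hline t))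
  -- The normal derivative is a limit of derivatives at points off `x`. Continuity up to `x` turns
  -- it into a genuine one-sided derivative at `0`, whose difference quotients `hk` controls.
  have h0 : HasDerivWithinAt (fun t : ℝ => L (w (x + t • ν))) (L a) (Ici 0) 0 := by
    refine hasDerivWithinAt_Ici_of_tendsto_deriv
      (s := {t : ℝ | DifferentiableAt ℝ w (x + t • ν)} ∩ Ioi 0) ?_ ?_
      (inter_mem hd self_mem_nhdsWithin) ?_
    · exact fun t ht => (hderiv t ht.1).differentiableAt.differentiableWithinAt
    · have : Tendsto (fun t : ℝ => L (w (x + t • ν))) (𝓝[>] 0) (𝓝 (L (w (x + (0 : ℝ) • ν)))) := by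
        simpa [Function.comp_def] using (L.continuous.tendsto _).comp hc
      exact this.mono_left (nhdsWithin_mono _ inter_subset_right)
    · refine ((L.continuous.tendsto a).comp ha).congr' ?_
      filter_upwards [hd] with t ht using (hderiv t ht).deriv.symm
  have hs := (hasDerivWithinAt_iff_tendsto_slope' (by simp)).1
    (h0.mono Ioi_subset_Ici_self)
  refine le_of_tendsto hs ?_
  filter_upwards [hk, self_mem_nhdsWithin] with t ht (ht0 : 0 < t)
  rw [slope_def_field, div_le_iff₀ (by simpa using ht0)]
  simp only [zero_smul, add_zero, sub_zero]
  linarith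

theorem hasInnerNormalDeriv_iff {f : ℂ → ℂ} {ν x a : ℂ} :
    HasInnerNormalDeriv f ν x a ↔ HasOuterNormalDeriv f (-ν) x (-a) := by
  simp only [HasInnerNormalDeriv, HasOuterNormalDeriv, smul_neg, ← sub_eq_add_neg, map_neg]
  exact ⟨fun h => h.neg, fun h => by simpa using h.neg⟩

theorem norm_add_smul_radialNormal {x : ℂ} (hx : x ≠ 0) {t : ℝ} (ht : -‖x‖ ≤ t) :
    ‖x + t • radialNormal x‖ = ‖x‖ + t := by
  have hn : (‖x‖ : ℂ) ≠ 0 := by simpa using hx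
  have : x + t • radialNormal x = ((‖x‖ + t : ℝ) : ℂ) * (x / ‖x‖) := by
    rw [radialNormal, Complex.real_smul]
    push_cast
    field_simp
  rw [this, norm_mul, norm_div, Complex.norm_real, Complex.norm_real, norm_norm,
    div_self (norm_ne_zero_iff.2 hx), mul_one, Real.norm_of_nonneg (by linarith)]

theorem tendsto_add_smul_nhdsGT (x ν : ℂ) :
    Tendsto (fun t : ℝ => x + t • ν) (𝓝[>] 0) (𝓝 x) := by
  have : Continuous fun t : ℝ => x + t • ν := by fun_prop
  simpa using (this.tendsto 0).mono_left nhdsWithin_le_nhds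

/-! ### Maximum principle for the homogeneous transmission problem -/

/-- A radial function, subharmonic off the circle of radius `r`, which increases outwards and whose
normal derivative jumps upwards on that circle. -/
noncomputable def barrier (r : ℝ) (x : ℂ) : ℝ := ‖x‖ ^ 2 + max (‖x‖ ^ 2 - r ^ 2) 0

theorem continuous_barrier (r : ℝ) : Continuous (barrier r) := by
  unfold barrier
  fun_prop

theorem barrier_nonneg (r : ℝ) (x : ℂ) : 0 ≤ barrier r x := by
  unfold barrier
  positivity

theorem barrier_of_le {r : ℝ} {x : ℂ} (h : ‖x‖ ≤ r) : barrier r x = ‖x‖ ^ 2 := by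
  rw [barrier, max_eq_right, add_zero]
  nlinarith [norm_nonneg x]

theorem barrier_of_ge {r : ℝ} {x : ℂ} (hr : 0 ≤ r) (h : r ≤ ‖x‖) :
    barrier r x = 2 * ‖x‖ ^ 2 - r ^ 2 := by
  rw [barrier, max_eq_left]
  · ring
  · nlinarith [norm_nonneg x]

/-- The homogeneous transmission problem outside the disk of radius `ri`, with interface the circle
of radius `re`. -/
structure IsHomogeneousTransmission (ri re : ℝ) (w : ℂ → ℂ) : Prop where
  continuousOn : ContinuousOn w (Metric.ball 0 ri)ᶜ
  harmonic_inside : HarmonicOnNhd w (Metric.ball 0 re \ closure (Metric.ball 0 ri))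
  harmonic_outside : HarmonicOnNhd w (closure (Metric.ball 0 re))ᶜ
  neumann : ∀ x : ℂ, ‖x‖ = ri → HasOuterNormalDeriv w (radialNormal x) x 0
  no_jump : ∀ x : ℂ, ‖x‖ = re → ∃ a,
    HasOuterNormalDeriv w (radialNormal x) x a ∧ HasInnerNormalDeriv w (radialNormal x) x a
  tendsto_zero : Tendsto w (Bornology.cobounded ℂ) (𝓝 0)

namespace IsHomogeneousTransmission

variable {ri re : ℝ} {w : ℂ → ℂ}

theorem harmonicAt (h : IsHomogeneousTransmission ri re w) (hri : 0 < ri) (hre : ri < re) {x : ℂ}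
    (h1 : ri < ‖x‖) (h2 : ‖x‖ ≠ re) : HarmonicAt w x := by
  rcases h2.lt_or_gt with h2 | h2
  · exact h.harmonic_inside x (by simp [closure_ball (0 : ℂ) hri.ne', h1, h2])
  · exact h.harmonic_outside x (by simp [closure_ball (0 : ℂ) (hri.trans hre).ne', h2])

/-- Serves outward rays (`σ = 1`) and inward rays (`σ = -1`) alike. Since `σ ≠ 0`, a ray starting on
the interface leaves it at once, so `w` is differentiable at the nearby points of the ray. -/
theorem map_le_of_isMaxOn (h : IsHomogeneousTransmission ri re w) (hri : 0 < ri) (hre : ri < re)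
    (L : ℂ →L[ℝ] ℝ) {x ν a : ℂ} {σ k : ℝ} (hσ : σ ≠ 0) (hx : ri ≤ ‖x‖)
    (hν : ∀ᶠ t : ℝ in 𝓝[>] 0, ‖x + t • ν‖ = ‖x‖ + σ * t)
    (ha : HasOuterNormalDeriv w ν x a) (hxσ : ri < ‖x‖ ∨ 0 < σ)
    (hk : ∀ᶠ t : ℝ in 𝓝[>] 0, L (w (x + t • ν)) + k * t ≤ L (w x)) : L a ≤ -k := by
  have hx' := tendsto_add_smul_nhdsGT x ν
  have hnorm : ∀ᶠ t : ℝ in 𝓝[>] 0, ri < ‖x + t • ν‖ := by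
    rcases hxσ with hlt | hpos
    · exact (hx'.norm).eventually (lt_mem_nhds hlt)
    · filter_upwards [hν, self_mem_nhdsWithin] with t ht (ht0 : 0 < t)
      rw [ht]
      nlinarith [mul_pos hpos ht0]
  have hne : ∀ᶠ t : ℝ in 𝓝[>] 0, ‖x + t • ν‖ ≠ re := by
    by_cases hxe : ‖x‖ = re
    · filter_upwards [hν, self_mem_nhdsWithin] with t ht (ht0 : 0 < t)
      rw [ht, hxe]
      simpa using ⟨hσ, ht0.ne'⟩
    · exact (hx'.norm).eventually (isOpen_ne.mem_nhds hxe)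
  refine ha.map_le L ?_ ?_ hk
  · refine (h.continuousOn x (by simpa using hx)).tendsto.comp
      (tendsto_nhdsWithin_iff.2 ⟨hx', ?_⟩)
    filter_upwards [hnorm] with t ht
    simpa using ht.le
  · filter_upwards [hnorm, hne] with t h1 h2
    exact (h.harmonicAt hri hre h1 h2).1.differentiableAt (by simp)

theorem map_nonpos (h : IsHomogeneousTransmission ri re w) (hri : 0 < ri) (hre : ri < re)
    (L : ℂ →L[ℝ] ℝ) {x₀ : ℂ} (hx₀ : ri ≤ ‖x₀‖) : L (w x₀) ≤ 0 := by
  by_contra! hm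
  have hre0 := hri.trans hre
  have hL : Tendsto (fun x => L (w x)) (Bornology.cobounded ℂ) (𝓝 0) := by
    simpa [Function.comp_def] using (L.continuous.tendsto 0).comp h.tendsto_zero
  obtain ⟨R, hR, hRe, hRx⟩ : ∃ R : ℝ, (∀ x : ℂ, R ≤ ‖x‖ → L (w x) < L (w x₀) / 2) ∧ re < R ∧
      ‖x₀‖ < R := by
    obtain ⟨R, -, hR⟩ := (Metric.hasBasis_cobounded_compl_closedBall (0 : ℂ)).eventually_iff.1
      (hL.eventually (gt_mem_nhds (half_pos hm)))
    refine ⟨max (R + 1) (max (re + 1) (‖x₀‖ + 1)), fun x hx => hR ?_, ?_, ?_⟩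
    · have := (le_max_left _ _).trans hx
      simp only [mem_compl_iff, Metric.mem_closedBall, dist_zero_right]
      linarith
    · have := (le_max_left _ _).trans (le_max_right (R + 1) (max (re + 1) (‖x₀‖ + 1)))
      linarith
    · have := (le_max_right _ _).trans (le_max_right (R + 1) (max (re + 1) (‖x₀‖ + 1)))
      linarith
  -- `M` is the value of the barrier on the circle of radius `R`. With this `ε` the perturbed
  -- function there stays below `L (w x₀) / 2 + L (w x₀) / 4`.
  set M := 2 * R ^ 2 - re ^ 2 with hM
  have hMpos : 0 < M := by nlinarith
  set ε := L (w x₀) / (4 * M) with hε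
  have hεpos : 0 < ε := by positivity
  have hεM : ε * M = L (w x₀) / 4 := by rw [hε]; field_simp
  set K : Set ℂ := (Metric.ball 0 ri)ᶜ ∩ Metric.closedBall 0 R with hK
  have hKc : IsCompact K := (isCompact_closedBall 0 R).inter_left Metric.isOpen_ball.isClosed_compl
  have hmem {x : ℂ} : x ∈ K ↔ ri ≤ ‖x‖ ∧ ‖x‖ ≤ R := by simp [hK]
  obtain ⟨y, hyK, hy⟩ := hKc.exists_isMaxOn (f := fun x => L (w x) + ε * barrier re x)
    ⟨x₀, hmem.2 ⟨hx₀, hRx.le⟩⟩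
    ((L.continuous.comp_continuousOn (h.continuousOn.mono inter_subset_left)).add
      (continuous_const.mul (continuous_barrier re)).continuousOn)
  have hmax {x : ℂ} (h1 : ri ≤ ‖x‖) (h2 : ‖x‖ ≤ R) :
      L (w x) + ε * barrier re x ≤ L (w y) + ε * barrier re y := hy (hmem.2 ⟨h1, h2⟩)
  obtain ⟨hy1, hy2⟩ := hmem.1 hyK
  have hy0 : y ≠ 0 := norm_pos_iff.1 (hri.trans_le hy1)
  have hνout : ∀ᶠ t : ℝ in 𝓝[>] 0, ‖y + t • radialNormal y‖ = ‖y‖ + 1 * t := by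
    filter_upwards [self_mem_nhdsWithin] with t (ht : 0 < t)
    rw [norm_add_smul_radialNormal hy0 (by linarith [norm_nonneg y]), one_mul]
  rcases hy2.eq_or_lt with hyR | hyR
  · have h1 := hmax hx₀ hRx.le
    have h2 := hR y hyR.ge
    rw [barrier_of_ge hre0.le (hRe.le.trans hyR.ge), hyR, ← hM, hεM] at h1
    have := mul_nonneg hεpos.le (barrier_nonneg re x₀)
    linarith
  have hsmall : ∀ᶠ t : ℝ in 𝓝[>] 0, ‖y‖ + t < R :=  by
    filter_upwards [Ioo_mem_nhdsGT (sub_pos.2 hyR)] with t ht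
    linarith [ht.2]
  -- On the inner circle the barrier has slope `2 * ri`, so maximality would force a normal
  -- derivative at most `-2 * ε * ri`, against the Neumann condition.
  rcases hy1.eq_or_lt with hyi | hyi
  · have := h.map_le_of_isMaxOn hri hre L (k := 2 * ε * ri) one_ne_zero hy1 hνout
      (h.neumann y hyi.symm) (.inr one_pos) ?_
    · rw [map_zero] at this
      have : 0 < 2 * ε * ri := by positivity
      linarith
    · filter_upwards [hνout, hsmall, self_mem_nhdsWithin, Ioo_mem_nhdsGT (sub_pos.2 hre)]
        with t h1 h2 (h3 : 0 < t) h4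
      have h5 := hmax (x := y + t • radialNormal y) (by linarith) (by linarith)
      rw [barrier_of_le (by linarith [h4.2]), barrier_of_le (by linarith), h1, ← hyi] at h5
      nlinarith [mul_pos hεpos (mul_pos h3 h3)]
  by_cases hye : ‖y‖ = re
  -- The barrier has slope `4 * re` outside and `2 * re` inside, so maximality on the two sides
  -- would give `-2 * ε * re ≤ L a ≤ -4 * ε * re`.
  · obtain ⟨a, ha, hb⟩ := h.no_jump y hye
    have hνin : ∀ᶠ t : ℝ in 𝓝[>] 0, ‖y + t • (-radialNormal y)‖ = ‖y‖ + (-1) * t := by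
      filter_upwards [Ioo_mem_nhdsGT (norm_pos_iff.2 hy0)] with t ht
      rw [smul_neg, ← neg_smul, norm_add_smul_radialNormal hy0 (by linarith [ht.2])]
      ring
    have h1 := h.map_le_of_isMaxOn hri hre L (k := 4 * ε * re) one_ne_zero hy1 hνout
      ha (.inl hyi) ?_
    · have h2 := h.map_le_of_isMaxOn hri hre L (k := -(2 * ε * re)) (by norm_num) hy1 hνin
        (hasInnerNormalDeriv_iff.1 hb) (.inl hyi) ?_
      · rw [map_neg] at h2
        have : 0 < ε * re := by positivity
        linarith
      · filter_upwards [hνin, self_mem_nhdsWithin, Ioo_mem_nhdsGT (sub_pos.2 hyi)]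
          with t h1 (h3 : 0 < t) h4
        have h5 := hmax (x := y + t • (-radialNormal y)) (by linarith [h4.2]) (by linarith)
        rw [barrier_of_le (by linarith), barrier_of_le hye.le, h1, hye] at h5
        nlinarith [mul_pos hεpos (mul_pos h3 h3)]
    · filter_upwards [hνout, hsmall, self_mem_nhdsWithin] with t h1 h2 (h3 : 0 < t)
      have h5 := hmax (x := y + t • radialNormal y) (by linarith) (by linarith)
      rw [barrier_of_ge hre0.le (by linarith), barrier_of_ge hre0.le hye.ge, h1, hye] at h5
      nlinarith [mul_pos hεpos (mul_pos h3 h3)]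
  have hu : HarmonicAt (L ∘ w) y := (h.harmonicAt hri hre hyi hye).comp_CLM L
  have hnear : ∀ᶠ x in 𝓝 y, ri ≤ ‖x‖ ∧ ‖x‖ ≤ R := by
    filter_upwards [continuous_norm.continuousAt.eventually (Ioo_mem_nhds hyi hyR)] with x hx
    exact ⟨hx.1.le, hx.2.le⟩
  -- Near `y` the barrier is `‖x‖ ^ 2` or `2 * ‖x‖ ^ 2` up to a constant, so the Laplacian of the
  -- sum is positive at an interior maximum.
  rcases lt_or_gt_of_ne hye with hlt | hgt
  · refine hu.not_isLocalMax_add_norm_sq hεpos ?_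
    filter_upwards [hnear, continuous_norm.continuousAt.eventually (gt_mem_nhds hlt)] with x h1 h2
    have h3 := hmax h1.1 h1.2
    rw [barrier_of_le h2.le, barrier_of_le hlt.le] at h3
    exact h3
  · refine hu.not_isLocalMax_add_norm_sq (mul_pos hεpos two_pos) ?_
    filter_upwards [hnear, continuous_norm.continuousAt.eventually (lt_mem_nhds hgt)] with x h1 h2
    have h3 := hmax h1.1 h1.2
    rw [barrier_of_ge hre0.le h2.le, barrier_of_ge hre0.le hgt.le] at h3
    simp only [Function.comp]
    linarith

theorem eq_zero (h : IsHomogeneousTransmission ri re w) (hri : 0 < ri) (hre : ri < re)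
    {x : ℂ} (hx : ri ≤ ‖x‖) : w x = 0 := by
  -- Testing against the direction of `w x` itself handles the complex value in one go.
  have h1 := h.map_nonpos hri hre (innerSL ℝ (w x)) hx
  rw [innerSL_apply_apply, real_inner_self_eq_norm_sq] at h1
  exact norm_eq_zero.1 (pow_eq_zero_iff two_ne_zero |>.1 (le_antisymm h1 (by positivity)))

end IsHomogeneousTransmission

/-! ### Calculus of one-sided normal derivatives -/

theorem HasOuterNormalDeriv.sub {f g : ℂ → ℂ} {ν x a b : ℂ} (hf : HasOuterNormalDeriv f ν x a)
    (hg : HasOuterNormalDeriv g ν x b)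
    (hdf : ∀ᶠ t : ℝ in 𝓝[>] 0, DifferentiableAt ℝ f (x + t • ν))
    (hdg : ∀ᶠ t : ℝ in 𝓝[>] 0, DifferentiableAt ℝ g (x + t • ν)) :
    HasOuterNormalDeriv (f - g) ν x (a - b) := by
  refine (Tendsto.sub hf hg).congr' ?_
  filter_upwards [hdf, hdg] with t h1 h2
  rw [fderiv_sub h1 h2, sub_apply]

theorem HasInnerNormalDeriv.sub {f g : ℂ → ℂ} {ν x a b : ℂ} (hf : HasInnerNormalDeriv f ν x a)
    (hg : HasInnerNormalDeriv g ν x b)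
    (hdf : ∀ᶠ t : ℝ in 𝓝[>] 0, DifferentiableAt ℝ f (x - t • ν))
    (hdg : ∀ᶠ t : ℝ in 𝓝[>] 0, DifferentiableAt ℝ g (x - t • ν)) :
    HasInnerNormalDeriv (f - g) ν x (a - b) := by
  refine (Tendsto.sub hf hg).congr' ?_
  filter_upwards [hdf, hdg] with t h1 h2
  rw [fderiv_sub h1 h2, sub_apply]

/-- Agreement is needed only near ray points off `x`, so a piecewise field inherits the derivative
of its smooth branch on that side. -/
theorem HasOuterNormalDeriv.congr {f g : ℂ → ℂ} {ν x a : ℂ} (hf : HasOuterNormalDeriv f ν x a)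
    (h : ∀ᶠ t : ℝ in 𝓝[>] 0, f =ᶠ[𝓝 (x + t • ν)] g) : HasOuterNormalDeriv g ν x a := by
  refine hf.congr' ?_
  filter_upwards [h] with t ht
  rw [ht.fderiv_eq]

theorem HasInnerNormalDeriv.congr {f g : ℂ → ℂ} {ν x a : ℂ} (hf : HasInnerNormalDeriv f ν x a)
    (h : ∀ᶠ t : ℝ in 𝓝[>] 0, f =ᶠ[𝓝 (x - t • ν)] g) : HasInnerNormalDeriv g ν x a := by
  refine hf.congr' ?_
  filter_upwards [h] with t ht
  rw [ht.fderiv_eq]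

theorem ContDiffAt.hasOuterNormalDeriv {f : ℂ → ℂ} {x : ℂ} (hf : ContDiffAt ℝ 2 f x) (ν : ℂ) :
    HasOuterNormalDeriv f ν x (fderiv ℝ f x ν) :=
  ((hf.fderiv_right (m := 1) (by norm_num)).continuousAt.clm_apply
    continuousAt_const).tendsto.comp (tendsto_add_smul_nhdsGT x ν)

theorem ContDiffAt.hasInnerNormalDeriv {f : ℂ → ℂ} {x : ℂ} (hf : ContDiffAt ℝ 2 f x) (ν : ℂ) :
    HasInnerNormalDeriv f ν x (fderiv ℝ f x ν) := by
  rw [hasInnerNormalDeriv_iff, ← map_neg]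
  exact hf.hasOuterNormalDeriv _

theorem eventually_norm_add_smul_radialNormal {x : ℂ} (hx : x ≠ 0) {r : ℝ} (hr : ‖x‖ < r) :
    ∀ᶠ t : ℝ in 𝓝[>] 0, ‖x‖ < ‖x + t • radialNormal x‖ ∧ ‖x + t • radialNormal x‖ < r := by
  filter_upwards [Ioo_mem_nhdsGT (sub_pos.2 hr)] with t ht
  rw [norm_add_smul_radialNormal hx (by linarith [ht.1, norm_nonneg x])]
  constructor <;> linarith [ht.1, ht.2]

theorem eventually_norm_sub_smul_radialNormal {x : ℂ} {r : ℝ} (hr0 : 0 ≤ r) (hr : r < ‖x‖) :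
    ∀ᶠ t : ℝ in 𝓝[>] 0, r < ‖x - t • radialNormal x‖ ∧ ‖x - t • radialNormal x‖ < ‖x‖ := by
  filter_upwards [Ioo_mem_nhdsGT (sub_pos.2 hr)] with t ht
  rw [sub_eq_add_neg, ← neg_smul, norm_add_smul_radialNormal (norm_pos_iff.1 (hr0.trans_lt hr))
    (by linarith [ht.2])]
  constructor <;> linarith [ht.1, ht.2]

theorem polarHarmonic_eq_pow (n : ℕ) (x : ℂ) : polarHarmonic n x = x ^ n := by
  conv_rhs => rw [← Complex.norm_mul_exp_arg_mul_I x]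
  rw [polarHarmonic, mul_pow, ← Complex.exp_nat_mul]
  congr 2
  ring

theorem tendsto_zero_of_isBigO_inv_norm {f g h : ℂ → ℂ}
    (hf : (fun x => f x - h x) =O[Bornology.cobounded ℂ] fun x => (‖x‖⁻¹ : ℝ))
    (hg : (fun x => g x - h x) =O[Bornology.cobounded ℂ] fun x => (‖x‖⁻¹ : ℝ)) :
    Tendsto (f - g) (Bornology.cobounded ℂ) (𝓝 0) := by
  have := (hf.sub hg).trans_tendsto
    (tendsto_inv_atTop_zero.comp (tendsto_norm_cobounded_atTop (E := ℂ)))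
  simpa [Pi.sub_def] using this

/-! ### Uniqueness for the electro-osmosis system -/

namespace IsAnnulusSolution

variable {n : ℕ} {ri re ζ₀ : ℝ} {φ φ' p p' : ℂ → ℂ}

theorem potential_harmonicAt (h : IsAnnulusSolution n ri re ζ₀ φ p) (hri : 0 < ri) {x : ℂ}
    (hx : ri < ‖x‖) : HarmonicAt φ x :=
  h.potential_harmonic x (by simp [closure_ball (0 : ℂ) hri.ne', hx])

theorem pressure_harmonicAt (h : IsAnnulusSolution n ri re ζ₀ φ p) (hri : 0 < ri) (hre : ri < re)
    {x : ℂ} (h1 : ri < ‖x‖) (h2 : ‖x‖ ≠ re) : HarmonicAt p x := by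
  rcases h2.lt_or_gt with h2 | h2
  · exact h.pressure_harmonic_inside x (by simp [closure_ball (0 : ℂ) hri.ne', h1, h2])
  · exact h.pressure_harmonic_outside x (by simp [closure_ball (0 : ℂ) (hri.trans hre).ne', h2])

theorem isHomogeneousTransmission_potential_sub (h : IsAnnulusSolution n ri re ζ₀ φ p)
    (h' : IsAnnulusSolution n ri re ζ₀ φ' p') (hri : 0 < ri) (hre : ri < re) :
    IsHomogeneousTransmission ri re (φ - φ') where
  continuousOn := h.potential_continuous.sub h'.potential_continuous
  harmonic_inside := (h.potential_harmonic.sub h'.potential_harmonic).mono fun x hx => hx.2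
  harmonic_outside := (h.potential_harmonic.sub h'.potential_harmonic).mono
    (compl_subset_compl.2 (closure_mono (Metric.ball_subset_ball hre.le)))
  neumann x hx := by
    have hx0 : x ≠ 0 := norm_pos_iff.1 (hx ▸ hri)
    have hfr : x ∈ frontier (Metric.ball (0 : ℂ) ri) := by simp [frontier_ball (0 : ℂ) hri.ne', hx]
    have hev := eventually_norm_add_smul_radialNormal hx0 (hx ▸ hre)
    rw [← sub_zero (0 : ℂ)]
    refine (h.potential_insulation x hfr).sub (h'.potential_insulation x hfr) ?_ ?_
    · filter_upwards [hev] with t ht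
      exact (h.potential_harmonicAt hri (hx ▸ ht.1)).1.differentiableAt (by simp)
    · filter_upwards [hev] with t ht
      exact (h'.potential_harmonicAt hri (hx ▸ ht.1)).1.differentiableAt (by simp)
  -- For the potential the interface is fictitious: the difference is `C²` across it.
  no_jump x hx := by
    have hd := ((h.potential_harmonicAt hri (hx ▸ hre)).sub
      (h'.potential_harmonicAt hri (hx ▸ hre))).1
    exact ⟨_, hd.hasOuterNormalDeriv _, hd.hasInnerNormalDeriv _⟩
  tendsto_zero := tendsto_zero_of_isBigO_inv_norm h.potential_infinity h'.potential_infinity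

theorem potential_eq (h : IsAnnulusSolution n ri re ζ₀ φ p)
    (h' : IsAnnulusSolution n ri re ζ₀ φ' p') (hri : 0 < ri) (hre : ri < re) {x : ℂ}
    (hx : ri ≤ ‖x‖) : φ x = φ' x :=
  sub_eq_zero.1 ((h.isHomogeneousTransmission_potential_sub h' hri hre).eq_zero hri hre hx)

theorem isHomogeneousTransmission_pressure_sub (h : IsAnnulusSolution n ri re ζ₀ φ p)
    (h' : IsAnnulusSolution n ri re ζ₀ φ' p') (hri : 0 < ri) (hre : ri < re) :
    IsHomogeneousTransmission ri re (p - p') where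
  continuousOn := h.pressure_continuous.sub h'.pressure_continuous
  harmonic_inside := h.pressure_harmonic_inside.sub h'.pressure_harmonic_inside
  harmonic_outside := h.pressure_harmonic_outside.sub h'.pressure_harmonic_outside
  neumann x hx := by
    have hx0 : x ≠ 0 := norm_pos_iff.1 (hx ▸ hri)
    have hfr : x ∈ frontier (Metric.ball (0 : ℂ) ri) := by simp [frontier_ball (0 : ℂ) hri.ne', hx]
    have hev := eventually_norm_add_smul_radialNormal hx0 (hx ▸ hre)
    rw [← sub_zero (0 : ℂ)]
    refine (h.pressure_no_penetration x hfr).sub (h'.pressure_no_penetration x hfr) ?_ ?_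
    · filter_upwards [hev] with t ht
      exact (h.pressure_harmonicAt hri hre (hx ▸ ht.1) ht.2.ne).1.differentiableAt (by simp)
    · filter_upwards [hev] with t ht
      exact (h'.pressure_harmonicAt hri hre (hx ▸ ht.1) ht.2.ne).1.differentiableAt (by simp)
  no_jump x hx := by
    have hre0 := hri.trans hre
    have hx0 : x ≠ 0 := norm_pos_iff.1 (hx ▸ hre0)
    have hfr : x ∈ frontier (Metric.ball (0 : ℂ) re) := by simp [frontier_ball (0 : ℂ) hre0.ne', hx]
    obtain ⟨a, b, ha, hb, hab⟩ := h.pressure_jump x hfr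
    obtain ⟨a', b', ha', hb', hab'⟩ := h'.pressure_jump x hfr
    -- Uniqueness of the potential makes the two prescribed flux jumps equal, so they cancel in `p -
    -- p'`.
    have hφ : φ =ᶠ[𝓝 x] φ' := by
      filter_upwards [continuous_norm.continuousAt.eventually (lt_mem_nhds (hx ▸ hre : ri < ‖x‖))]
        with y hy using h.potential_eq h' hri hre hy.le
    rw [hφ.fderiv_eq, ← hab'] at hab
    have hout := eventually_norm_add_smul_radialNormal hx0 (lt_add_one ‖x‖)
    have hin := eventually_norm_sub_smul_radialNormal hri.le (hx ▸ hre : ri < ‖x‖)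
    refine ⟨a - a', ha.sub ha' ?_ ?_, ?_⟩
    · filter_upwards [hout] with t ht
      exact (h.pressure_harmonicAt hri hre (by linarith) (by linarith)).1.differentiableAt (by simp)
    · filter_upwards [hout] with t ht
      exact (h'.pressure_harmonicAt hri hre (by linarith) (hx ▸ ht.1.ne')).1.differentiableAt
        (by simp)
    rw [show a - a' = b - b' by linear_combination hab]
    refine hb.sub hb' ?_ ?_
    · filter_upwards [hin] with t ht
      exact (h.pressure_harmonicAt hri hre ht.1 (hx ▸ ht.2.ne)).1.differentiableAt (by simp)
    · filter_upwards [hin] with t ht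
      exact (h'.pressure_harmonicAt hri hre ht.1 (hx ▸ ht.2.ne)).1.differentiableAt (by simp)
  tendsto_zero := tendsto_zero_of_isBigO_inv_norm h.pressure_infinity h'.pressure_infinity

theorem pressure_eq (h : IsAnnulusSolution n ri re ζ₀ φ p)
    (h' : IsAnnulusSolution n ri re ζ₀ φ' p') (hri : 0 < ri) (hre : ri < re) {x : ℂ}
    (hx : ri ≤ ‖x‖) : p x = p' x :=
  sub_eq_zero.1 ((h.isHomogeneousTransmission_pressure_sub h' hri hre).eq_zero hri hre hx)

end IsAnnulusSolution

/-! ### The explicit solution -/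

/-- The harmonic field `(α r ^ n + β r ^ (-n)) exp (i n θ)`. -/
noncomputable def annularField (n : ℕ) (α β : ℂ) (x : ℂ) : ℂ :=
  α * x ^ n + β * (starRingEnd ℂ) (x ^ n)⁻¹

theorem annularField_eq {n : ℕ} {α β x : ℂ} (hx : x ≠ 0) :
    annularField n α β x = (α + β / (‖x‖ : ℂ) ^ (2 * n)) * x ^ n := by
  have hn : (‖x‖ : ℂ) ≠ 0 := by simpa using hx
  have hc : (starRingEnd ℂ) x ≠ 0 := by simpa using hx
  rw [annularField, add_mul, pow_mul, ← Complex.mul_conj', map_inv₀, map_pow, mul_pow]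
  field_simp

/-- The second term is a real-linear image of the holomorphic function `(x ^ n)⁻¹`. -/
theorem harmonicAt_annularField (n : ℕ) (α β : ℂ) {x : ℂ} (hx : x ≠ 0) :
    HarmonicAt (annularField n α β) x := by
  have h1 : HarmonicAt (fun x : ℂ => α * x ^ n) x :=
    AnalyticAt.harmonicAt (analyticAt_const.mul (analyticAt_id.pow n))
  have h2 : HarmonicAt (fun x : ℂ => (x ^ n)⁻¹) x :=
    AnalyticAt.harmonicAt ((analyticAt_id.pow n).inv (pow_ne_zero n hx))
  have h3 := (h2.comp_CLM (Complex.conjCLE : ℂ →L[ℝ] ℂ)).comp_CLM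
    ((ContinuousLinearMap.mul ℝ ℂ) β)
  exact h1.add h3

theorem fderiv_annularField_radialNormal (n : ℕ) (α β : ℂ) {x : ℂ} (hx : x ≠ 0) :
    fderiv ℝ (annularField n α β) x (radialNormal x) =
      (α - β / (‖x‖ : ℂ) ^ (2 * n)) * (n * x ^ n / ‖x‖) := by
  have hn : (‖x‖ : ℂ) ≠ 0 := by simpa using hx
  set γ : ℝ → ℂ := fun t => x + t • radialNormal x
  have hγ : HasDerivAt γ (radialNormal x) 0 := by
    simpa [γ] using ((hasDerivAt_id (0 : ℝ)).smul_const (radialNormal x)).const_add x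
  have hγ0 : γ 0 = x := by simp [γ]
  have hd : HasFDerivAt (annularField n α β) (fderiv ℝ (annularField n α β) x) (γ 0) := by
    rw [hγ0]
    exact ((harmonicAt_annularField n α β hx).1.differentiableAt (by simp)).hasFDerivAt
  have h1 := hd.comp_hasDerivAt 0 hγ
  have hr : HasDerivAt (fun t : ℝ => ((‖x‖ + t : ℝ) : ℂ)) 1 0 := by
    simpa using ((hasDerivAt_id (0 : ℝ)).const_add ‖x‖).ofReal_comp
  have hr0 : (((‖x‖ + 0 : ℝ) : ℂ)) ≠ 0 := by simpa using hx
  have h2 := (((hr.pow n).const_mul α).add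
    (((hr.pow n).inv (pow_ne_zero n hr0)).const_mul β)).mul_const ((x / ‖x‖) ^ n)
  have heq : (annularField n α β ∘ γ) =ᶠ[𝓝 0] fun t : ℝ =>
      (α * ((‖x‖ + t : ℝ) : ℂ) ^ n + β * (((‖x‖ + t : ℝ) : ℂ) ^ n)⁻¹) * (x / ‖x‖) ^ n := by
    filter_upwards [lt_mem_nhds (neg_lt_zero.2 (norm_pos_iff.2 hx))] with t ht
    have hpos : 0 < ‖x‖ + t := by linarith
    have hne : ((‖x‖ + t : ℝ) : ℂ) ≠ 0 := by exact_mod_cast hpos.ne'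
    have hγt : γ t = ((‖x‖ + t : ℝ) : ℂ) * (x / ‖x‖) := by
      simp only [γ, radialNormal, Complex.real_smul]
      push_cast
      field_simp
    have hnorm : ‖γ t‖ = ‖x‖ + t := norm_add_smul_radialNormal hx ht.le
    have hγ0 : γ t ≠ 0 := norm_pos_iff.1 (hnorm ▸ hpos)
    rw [Function.comp, annularField_eq hγ0, hnorm, hγt, mul_pow, pow_mul, pow_two]
    field_simp
    ring
  have := h1.unique (h2.congr_of_eventuallyEq heq)
  rw [this]
  -- The power rule produces the truncated exponent `n - 1`, so `n = 0` is separate.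
  rcases n with _ | n
  · simp
  · simp only [Pi.pow_apply, add_zero, Nat.add_sub_cancel, mul_one, div_pow]
    field_simp
    ring

theorem isBigO_annularField_sub {n : ℕ} (hn : 1 ≤ n) (α β : ℂ) :
    (fun x => annularField n α β x - α * polarHarmonic n x) =O[Bornology.cobounded ℂ]
      fun x => (‖x‖⁻¹ : ℝ) := by
  refine IsBigO.of_bound ‖β‖ ?_
  filter_upwards [tendsto_norm_cobounded_atTop.eventually_ge_atTop 1] with x hx
  rw [polarHarmonic_eq_pow, annularField, add_sub_cancel_left, norm_mul, RCLike.norm_conj,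
    norm_inv, norm_pow, norm_inv, norm_norm]
  gcongr
  exact le_self_pow₀ hx (by lia)

/-- The pressure field with coefficient `a` in the annulus and decaying coefficient `c` outside. -/
noncomputable def annulusPressure (n : ℕ) (ri re a c : ℝ) (x : ℂ) : ℂ :=
  if ‖x‖ < re then annularField n a (a * ri ^ (2 * n)) x else annularField n 12 c x

section ExplicitSolution

variable {n : ℕ} {ri re a c : ℝ} {x : ℂ}

theorem annulusPressure_of_lt (h : ‖x‖ < re) :
    annulusPressure n ri re a c x = annularField n a (a * ri ^ (2 * n)) x := if_pos h

theorem annulusPressure_of_ge (h : re ≤ ‖x‖) :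
    annulusPressure n ri re a c x = annularField n 12 c x := if_neg h.not_gt

theorem annulusPressure_eventuallyEq_of_lt (h : ‖x‖ < re) :
    annulusPressure n ri re a c =ᶠ[𝓝 x] annularField n a (a * ri ^ (2 * n)) := by
  filter_upwards [continuous_norm.continuousAt.eventually (gt_mem_nhds h)] with y hy
    using annulusPressure_of_lt hy

theorem annulusPressure_eventuallyEq_of_gt (h : re < ‖x‖) :
    annulusPressure n ri re a c =ᶠ[𝓝 x] annularField n 12 c := by
  filter_upwards [continuous_norm.continuousAt.eventually (lt_mem_nhds h)] with y hy
    using annulusPressure_of_ge hy.le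

theorem continuousOn_annularField (n : ℕ) (α β : ℂ) : ContinuousOn (annularField n α β) {0}ᶜ :=
  fun _ hx => (harmonicAt_annularField n α β hx).1.continuousAt.continuousWithinAt

theorem continuousOn_annulusPressure (hre : 0 < re)
    (hcont : 12 * re ^ (2 * n) + c = a * (re ^ (2 * n) + ri ^ (2 * n))) :
    ContinuousOn (annulusPressure n ri re a c) {0}ᶜ := by
  refine ContinuousOn.if ?_ ((continuousOn_annularField n _ _).mono inter_subset_left)
    ((continuousOn_annularField n _ _).mono inter_subset_left)
  rintro x ⟨hx0, hx⟩
  have hx : ‖x‖ = re := by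
    have := frontier_lt_subset_eq continuous_norm continuous_const hx
    simpa using this
  have hx0 : x ≠ 0 := hx0
  have hc : (12 * re ^ (2 * n) + c : ℂ) = a * (re ^ (2 * n) + ri ^ (2 * n)) := by
    exact_mod_cast hcont
  have hrec : (re : ℂ) ≠ 0 := by exact_mod_cast hre.ne'
  rw [annularField_eq hx0, annularField_eq hx0, hx]
  congr 1
  field_simp
  linear_combination -hc

/-- `hcont` and `hjump` are the two interface conditions at `re`, with the common angular factor
removed and denominators cleared by `re ^ (2 * n)`. -/
theorem isAnnulusSolution_annularField {ζ₀ : ℝ} (hn : 1 ≤ n) (hri : 0 < ri) (hre : ri < re)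
    (hcont : 12 * re ^ (2 * n) + c = a * (re ^ (2 * n) + ri ^ (2 * n)))
    (hjump : 12 * re ^ (2 * n) - c - a * (re ^ (2 * n) - ri ^ (2 * n)) =
      12 * ζ₀ * (re ^ (2 * n) - ri ^ (2 * n))) :
    IsAnnulusSolution n ri re ζ₀ (annularField n 1 (ri ^ (2 * n)))
      (annulusPressure n ri re a c) := by
  have hre0 := hri.trans hre
  have hric : (ri : ℂ) ≠ 0 := by exact_mod_cast hri.ne'
  have hrec : (re : ℂ) ≠ 0 := by exact_mod_cast hre0.ne'
  have hsub : (Metric.ball (0 : ℂ) ri)ᶜ ⊆ {0}ᶜ := by simpa using hri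
  refine ⟨fun x hx => harmonicAt_annularField _ _ _ ?_, (continuousOn_annularField _ _ _).mono hsub,
    fun x hx => ?_, by simpa using isBigO_annularField_sub hn 1 _, fun x hx => ?_, fun x hx => ?_,
    (continuousOn_annulusPressure hre0 hcont).mono hsub, fun x hx => ?_, fun x hx => ?_, ?_⟩
  · exact norm_pos_iff.1 (hri.trans (by simpa [closure_ball (0 : ℂ) hri.ne'] using hx))
  · have hx : ‖x‖ = ri := by simpa [frontier_ball (0 : ℂ) hri.ne'] using hx
    have hx0 : x ≠ 0 := norm_pos_iff.1 (hx ▸ hri)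
    have h := (harmonicAt_annularField n 1 (ri ^ (2 * n)) hx0).1.hasOuterNormalDeriv
      (radialNormal x)
    rwa [fderiv_annularField_radialNormal _ _ _ hx0, hx, div_self (pow_ne_zero _ hric), sub_self,
      zero_mul] at h
  · have hx : ‖x‖ < re ∧ ri < ‖x‖ := by simpa [closure_ball (0 : ℂ) hri.ne'] using hx
    exact (harmonicAt_congr_nhds (annulusPressure_eventuallyEq_of_lt hx.1)).2
      (harmonicAt_annularField _ _ _ (norm_pos_iff.1 (hri.trans hx.2)))
  · have hx : re < ‖x‖ := by simpa [closure_ball (0 : ℂ) hre0.ne'] using hx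
    exact (harmonicAt_congr_nhds (annulusPressure_eventuallyEq_of_gt hx)).2
      (harmonicAt_annularField _ _ _ (norm_pos_iff.1 (hre0.trans hx)))
  · have hx : ‖x‖ = ri := by simpa [frontier_ball (0 : ℂ) hri.ne'] using hx
    have hx0 : x ≠ 0 := norm_pos_iff.1 (hx ▸ hri)
    have h := (harmonicAt_annularField n a (a * ri ^ (2 * n)) hx0).1.hasOuterNormalDeriv
      (radialNormal x)
    rw [fderiv_annularField_radialNormal _ _ _ hx0, hx,
      mul_div_cancel_right₀ _ (pow_ne_zero _ hric), sub_self, zero_mul] at h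
    refine h.congr ?_
    filter_upwards [eventually_norm_add_smul_radialNormal hx0 (hx ▸ hre)] with t ht
    exact (annulusPressure_eventuallyEq_of_lt ht.2).symm
  · have hx : ‖x‖ = re := by simpa [frontier_ball (0 : ℂ) hre0.ne'] using hx
    have hx0 : x ≠ 0 := norm_pos_iff.1 (hx ▸ hre0)
    refine ⟨_, _, ((harmonicAt_annularField n 12 c hx0).1.hasOuterNormalDeriv
      (radialNormal x)).congr ?_, ((harmonicAt_annularField n a (a * ri ^ (2 * n))
      hx0).1.hasInnerNormalDeriv (radialNormal x)).congr ?_, ?_⟩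
    · filter_upwards [eventually_norm_add_smul_radialNormal hx0 (lt_add_one ‖x‖)] with t ht
      exact (annulusPressure_eventuallyEq_of_gt (hx ▸ ht.1)).symm
    · filter_upwards [eventually_norm_sub_smul_radialNormal hri.le (hx ▸ hre : ri < ‖x‖)] with t ht
      exact (annulusPressure_eventuallyEq_of_lt (hx ▸ ht.2)).symm
    · have hj : (12 * re ^ (2 * n) - c - a * (re ^ (2 * n) - ri ^ (2 * n)) : ℂ) =
          12 * ζ₀ * (re ^ (2 * n) - ri ^ (2 * n)) := by exact_mod_cast hjump
      simp only [fderiv_annularField_radialNormal _ _ _ hx0, hx]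
      field_simp
      linear_combination (n : ℂ) * hj
  · refine (isBigO_annularField_sub hn 12 c).congr' ?_ EventuallyEq.rfl
    filter_upwards [tendsto_norm_cobounded_atTop.eventually_ge_atTop re] with x hx
    rw [annulusPressure_of_ge hx]

end ExplicitSolution

/-! ### Cloaking and shielding -/

theorem planeGrad_congr {f g : ℂ → ℂ} {x : ℂ} (h : f =ᶠ[𝓝 x] g) : planeGrad f x = planeGrad g x := by
  rw [planeGrad, planeGrad, h.fderiv_eq]

theorem hydrodynamicForce_eq_zero {D : Set ℂ} {ν p : ℂ → ℂ} (h : ∀ x ∈ frontier D, p x = 0) :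
    hydrodynamicForce D ν p = 0 := by
  rw [hydrodynamicForce, setIntegral_congr_fun (g := fun _ => 0) isClosed_frontier.measurableSet,
    integral_zero]
  intro x hx
  simp [stressTensor, h x hx]

theorem mainTheorem1 (n : ℕ) (hn : 1 ≤ n) (ri re : ℝ) (hri : 0 < ri) (hre : ri < re) :
    -- perfect cloaking
    (∀ ζ₀ : ℝ, ζ₀ = 2 * ri ^ (2 * n) * re ^ (2 * n) / (re ^ (4 * n) - ri ^ (4 * n)) →
      (∃ φ p : ℂ → ℂ, IsAnnulusSolution n ri re ζ₀ φ p) ∧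
      ∀ φ p : ℂ → ℂ, IsAnnulusSolution n ri re ζ₀ φ p →
        (∀ x ∈ (closure (Metric.ball (0 : ℂ) re))ᶜ, p x = 12 * polarHarmonic n x) ∧
        (∀ x ∈ (closure (Metric.ball (0 : ℂ) re))ᶜ,
          averageVelocity (Metric.ball 0 ri) (Metric.ball 0 re) ζ₀ φ p x =
            -((1 / 12 : ℂ) • planeGrad (fun y => 12 * polarHarmonic n y) x))) ∧
    -- perfect shielding
    (∀ ζ₀ : ℝ, ζ₀ = 2 * re ^ (2 * n) / (re ^ (2 * n) - ri ^ (2 * n)) →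
      (∃ φ p : ℂ → ℂ, IsAnnulusSolution n ri re ζ₀ φ p) ∧
      ∀ φ p : ℂ → ℂ, IsAnnulusSolution n ri re ζ₀ φ p →
        (∀ x ∈ Metric.ball (0 : ℂ) re \ closure (Metric.ball (0 : ℂ) ri), p x = 0) ∧
        hydrodynamicForce (Metric.ball 0 ri) radialNormal p = 0) := by
  have hre0 := hri.trans hre
  have hs : 0 < ri ^ (2 * n) := pow_pos hri _
  have hq : 0 < re ^ (2 * n) := pow_pos hre0 _
  have hsq : ri ^ (2 * n) < re ^ (2 * n) := pow_lt_pow_left₀ hre hri.le (by lia)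
  have hsub : re ^ (2 * n) - ri ^ (2 * n) ≠ 0 := (sub_pos.2 hsq).ne'
  have hadd : re ^ (2 * n) + ri ^ (2 * n) ≠ 0 := (add_pos hq hs).ne'
  refine ⟨fun ζ₀ hζ => ?_, fun ζ₀ hζ => ?_⟩
  -- No scattered pressure: `c = 0`, and continuity then determines `a`.
  · have hsol : IsAnnulusSolution n ri re ζ₀ (annularField n 1 (ri ^ (2 * n)))
        (annulusPressure n ri re (12 * re ^ (2 * n) / (re ^ (2 * n) + ri ^ (2 * n))) 0) := by
      refine isAnnulusSolution_annularField hn hri hre ?_ ?_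
      · field_simp
        ring
      · have hfac : re ^ (4 * n) - ri ^ (4 * n) =
            (re ^ (2 * n) + ri ^ (2 * n)) * (re ^ (2 * n) - ri ^ (2 * n)) := by ring
        rw [hζ, hfac]
        field_simp
        ring
    refine ⟨⟨_, _, hsol⟩, fun φ p h => ?_⟩
    have hp : ∀ x ∈ (closure (Metric.ball (0 : ℂ) re))ᶜ, p x = 12 * polarHarmonic n x := by
      intro x hx
      have hx : re < ‖x‖ := by simpa [closure_ball (0 : ℂ) hre0.ne'] using hx
      rw [h.pressure_eq hsol hri hre (hre.trans hx).le, annulusPressure_of_ge hx.le,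
        polarHarmonic_eq_pow]
      simp [annularField]
    refine ⟨hp, fun x hx => ?_⟩
    have hΩ : x ∉ Metric.ball (0 : ℂ) re \ closure (Metric.ball 0 ri) :=
      fun hx' => hx (subset_closure hx'.1)
    rw [averageVelocity, zetaMean, indicator_of_notMem hΩ,
      planeGrad_congr (eventually_of_mem (isClosed_closure.isOpen_compl.mem_nhds hx) hp)]
    simp
  -- No pressure in the annulus: `a = 0`, and continuity then determines `c`.
  · have hsol : IsAnnulusSolution n ri re ζ₀ (annularField n 1 (ri ^ (2 * n)))
        (annulusPressure n ri re 0 (-(12 * re ^ (2 * n)))) := by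
      refine isAnnulusSolution_annularField hn hri hre (by ring) ?_
      rw [hζ]
      field_simp
      ring
    refine ⟨⟨_, _, hsol⟩, fun φ p h => ?_⟩
    -- The circle `‖x‖ = ri` is included because the force is an integral over it.
    have hp {x : ℂ} (h1 : ri ≤ ‖x‖) (h2 : ‖x‖ < re) : p x = 0 := by
      rw [h.pressure_eq hsol hri hre h1, annulusPressure_of_lt h2]
      simp [annularField]
    refine ⟨fun x hx => ?_, hydrodynamicForce_eq_zero fun x hx => ?_⟩
    · have hx : ‖x‖ < re ∧ ri < ‖x‖ := by simpa [closure_ball (0 : ℂ) hri.ne'] using hx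
      exact hp hx.2.le hx.1
    · have hx : ‖x‖ = ri := by simpa [frontier_ball (0 : ℂ) hri.ne'] using hx
      exact hp hx.ge (hx ▸ hre)
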